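/- Let $P,Q\in L_1(0,\pi)$ be complex-valued and let $\mathbb{H}=L_2(0,\pi)\oplus L_2(0,\pi)$ with the inner product $\langle\mathbf f,\mathbf g\rangle=\int_0^\pi\bigl(f_1\overline{g_1}+f_2\overline{g_2}\bigr)\,dx$. Put $$B=\begin{pmatrix}-i&0\\0&i\end{pmatrix},\qquad V=\begin{pmatrix}0&P\\Q&0\end{pmatrix},\qquad V^*=\begin{pmatrix}0&\overline{Q}\\\overline{P}&0\end{pmatrix}.$$ Let $\mathbb{L}\mathbf y=B\mathbf y'+V\mathbf y$ be the maximal operator with domain $D(\mathbb{L})=\{\mathbf y\in W_1^1[0,\pi]\oplus W_1^1[0,\pi]:\ B\mathbf y'+V\mathbf y\in\mathbb{H}\}$, and let $\mathbb{L}^*\mathbf z=B\mathbf z'+V^*\mathbf z$ be its formal adjoint, with domain defined in the same way (no boundary conditions are imposed on either operator). For an operator $A\in\{\mathbb{L},\mathbb{L}^*\}$ and $\mu\in\mathbb{C}$, an eigenfunction for the eigenvalue $\mu$ is a function $\overset{0}{\mathbf y}\in D(A)$, $\overset{0}{\mathbf y}\not\equiv0$, with $A\overset{0}{\mathbf y}=\mu\overset{0}{\mathbf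 y}$ a.e. on $(0,\pi)$; an associated function of order $l\ge1$ for $\mu$ is a function $\overset{l}{\mathbf y}\in D(A)$ with $A\overset{l}{\mathbf y}=\mu\overset{l}{\mathbf y}+\overset{l-1}{\mathbf y}$ a.e. on $(0,\pi)$, where $\overset{l-1}{\mathbf y}$ is an eigenfunction for $\mu$ if $l=1$ and an associated function of order $l-1$ for $\mu$ if $l\ge2$. Theorem. Suppose that 1) $\{\mathbf y_n\}_{n\in\mathbb{N}}$ is a complete (the closed linear span of the system is $\mathbb{H}$) and minimal (no $\mathbf y_n$ lies in the closed linear span of the others) system in $\mathbb{H}$ that consists of eigenfunctions and associated functions of $\mathbb{L}$, with corresponding eigenvalues $\lambda_n$; 2) the biorthogonal system $\{\mathbf z_n\}_{n\in\mathbb{N}}$, $\langle\mathbf y_n,\mathbf z_k\rangle=\delta_{n,k}$, consists of eigenfunctions and associated functions of $\mathbb{L}^*$, with corresponding eigenvalues $\overline{\lambda_n}$; 3) each of the systems $\{\mathbf y_n\}$ and $\{\mathbf z_n\}$ contains only finitely many associated functions; 4) $\limsup_{n\to\infty}|\operatorname{Im}\lambda_n|=\infty$. Then $\{\mathbf y_n\}$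 is not a (Schauder) basis of $\mathbb{H}$. -/

import Mathlib

open MeasureTheory Set Filter
open scoped ComplexConjugate InnerProductSpace

namespace Dirac

/-- Lebesgue measure on the interval `(0, π)`. -/
noncomputable abbrev intervalMeasure : Measure ℝ := volume.restrict (Ioo 0 Real.pi)

/-- The Hilbert space `L₂(0, π) ⊕ L₂(0, π)` of complex-valued functions. Mathlib's inner product
`⟪f, g⟫_ℂ` is linear in the second argument: it is the integral of
`conj f₁ * g₁ + conj f₂ * g₂`. -/
abbrev H : Type := WithLp 2 (Lp ℂ 2 intervalMeasure × Lp ℂ 2 intervalMeasure)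

/-- The graph of the maximal Dirac operator `L y = B y' + V y` in `H`, where `B = diag(-i, i)` and
`V` has rows `(0, P)` and `(Q, 0)`. `MaximalGraph P Q y w` says that `y ∈ D(L)` and `L y = w`:
the components of `y` have representatives `u₁, u₂` in `W₁¹[0, π]`, that is, absolutely continuous
on `[0, π]`, and the function `B u' + V u` belongs to `H`, being equal to `w` almost everywhere. -/
def MaximalGraph (P Q : ℝ → ℂ) (y w : H) : Prop :=
  ∃ u₁ u₂ : ℝ → ℂ,
    AbsolutelyContinuousOnInterval u₁ 0 Real.pi ∧
    AbsolutelyContinuousOnInterval u₂ 0 Real.pi ∧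
    (∀ᵐ x ∂intervalMeasure, y.fst x = u₁ x ∧ y.snd x = u₂ x) ∧
    (∀ᵐ x ∂intervalMeasure,
      w.fst x = -Complex.I * deriv u₁ x + P x * u₂ x ∧
      w.snd x = Complex.I * deriv u₂ x + Q x * u₁ x)

/-- The graph of the formally adjoint operator `L* z = B z' + V* z`, where `V*` has rows
`(0, conj Q)` and `(conj P, 0)`, with its maximal domain. -/
def AdjointGraph (P Q : ℝ → ℂ) (z w : H) : Prop :=
  MaximalGraph (fun x => conj (Q x)) (fun x => conj (P x)) z w

/-- `IsRootFunction G lam l y`: `y` is a root function of order `l`, for the eigenvalue `lam`, of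
the operator with graph `G`. For `l = 0` it is an eigenfunction; for `l ≥ 1` it is an associated
function of order `l`, the last term of a chain that starts at an eigenfunction. -/
def IsRootFunction (G : H → H → Prop) (lam : ℂ) : ℕ → H → Prop
  | 0, y => y ≠ 0 ∧ G y (lam • y)
  | l + 1, y => ∃ y' : H, IsRootFunction G lam l y' ∧ G y (lam • y + y')

/-- A system is complete if the closure of its linear span is the whole space. -/
def IsCompleteSystem (y : ℕ → H) : Prop :=
  (Submodule.span ℂ (range y)).topologicalClosure = ⊤

/-- A system is minimal if no member lies in the closed linear span of the others. -/
def IsMinimalSystem (y : ℕ → H) : Prop :=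
  ∀ n, y n ∉ (Submodule.span ℂ (y '' {n}ᶜ)).topologicalClosure

/-- `y` is a (Schauder) basis of `H`. -/
def IsBasis (y : ℕ → H) : Prop :=
  ∃ b : SchauderBasis ℂ H, b.basis = y

end Dirac

/-!
A Schauder basis `y` with biorthogonal system `z` is uniformly minimal: the products
`‖y n‖ * ‖z n‖` are bounded (`Dirac.exists_norm_mul_norm_le_of_schauderBasis`). On the other hand,
`⟪z n, y n⟫ = 1`, and for eigenfunctions `y` of `L` and `z` of `L*` with conjugate eigenvalues the
quotient `|⟪z, y⟫| / (‖y‖ * ‖z‖)` tends to `0` as `τ = |Im λ|` tends to infinity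
(`Dirac.norm_inner_le_of_eigenfunctions`). Since only finitely many members of the systems are
associated functions and `|Im λ n|` is unbounded along the sequence, this is a contradiction.

The reason for the near orthogonality is visible for zero potential. If `Im λ = τ > 0`, then `y` is
a combination of `exp (iλx)` in the first component, which lives near the left end, and
`exp (-iλx)` in the second, which lives near the right end; for `z` the roles of the ends are
interchanged. So the pointwise product `y₁ * conj z₁` has size `exp (-τπ)` relative to the boundary
amplitudes `m` and `n` of `y` and `z`, while `‖y‖ * ‖z‖` is of order `m * n / τ`.

Integrable potentials are a small perturbation of this picture for large `τ`. With the weight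
`w x = exp (-τx/2) + exp (-τ(π-x)/2)`, variation of constants leads to the integrals
`∫ exp (-τ|x-t|/2) (|P t| + |Q t|) dt`, which are at most `ε` uniformly in `x` once `τ` is large
(`Dirac.eventually_integral_exp_abs_mul_le`). An absorption argument for the maximum of
`max |u₁| |u₂| / w` then shows that each component differs from a free solution by at most
`2 ε m w` (`Dirac.IsNearlyDiagonal.norm_sub_edge_exp_le`). As `∫ w²` is of order `1 / τ`, the lower
bound for the norms survives and the pairing is at most a constant times
`(τ exp (-τπ) + ε) * ‖y‖ * ‖z‖` (`Dirac.IsNearlyDiagonal.integral_pairing_le`).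
-/

namespace Dirac

/-! ### Absolutely continuous functions and uniform smallness of exponential kernels -/

/-- Mean value inequality for absolutely continuous complex-valued functions. Mathlib's fundamental
theorem of calculus for absolutely continuous functions is real-valued, so it is applied to
`Re (c * v)`, where the unimodular constant `c` rotates `v b - v a` onto the positive half-axis. -/
theorem norm_sub_le_integral_of_norm_deriv_le {v : ℝ → ℂ} {a b : ℝ} (hab : a ≤ b)
    (hv : AbsolutelyContinuousOnInterval v a b) {g : ℝ → ℝ} (hg : IntervalIntegrable g volume a b)
    (hvg : ∀ᵐ x, x ∈ Ioo a b → ‖deriv v x‖ ≤ g x) :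
    ‖v b - v a‖ ≤ ∫ x in a..b, g x := by
  obtain ⟨c, hc, hcv⟩ : ∃ c : ℂ, ‖c‖ = 1 ∧ (c * (v b - v a)).re = ‖v b - v a‖ := by
    rcases eq_or_ne (v b - v a) 0 with h | h
    · exact ⟨1, by simp, by simp [h]⟩
    · have hn : (‖v b - v a‖ : ℂ) ≠ 0 := by simpa using h
      refine ⟨conj (v b - v a) / ‖v b - v a‖, ?_, ?_⟩
      · rw [norm_div, RCLike.norm_conj, Complex.norm_real, norm_norm, div_self (by simpa using h)]
      · rw [div_mul_eq_mul_div, mul_comm, Complex.mul_conj, Complex.normSq_eq_norm_sq,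
          Complex.ofReal_pow, sq, mul_div_assoc, div_self hn, mul_one, Complex.ofReal_re]
  let f : ℝ → ℝ := fun x => (c * v x).re
  have hf : AbsolutelyContinuousOnInterval f a b := by
    refine squeeze_zero (fun E => Finset.sum_nonneg fun i _ => dist_nonneg) (fun E => ?_) hv
    refine Finset.sum_le_sum fun i _ => ?_
    rw [Real.dist_eq, dist_eq_norm]
    calc |f _ - f _| = |(c * (v (E.2 i).1 - v (E.2 i).2)).re| := by
          simp only [f, mul_sub, Complex.sub_re]
      _ ≤ ‖c * (v (E.2 i).1 - v (E.2 i).2)‖ := Complex.abs_re_le_norm _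
      _ = _ := by rw [norm_mul, hc, one_mul]
  have hsub : f b - f a = ‖v b - v a‖ := by
    rw [← hcv]; simp only [f, mul_sub, Complex.sub_re]
  rw [← hsub, ← hf.integral_deriv_eq_sub]
  refine intervalIntegral.integral_mono_ae_restrict hab hf.intervalIntegrable_deriv hg ?_
  rw [EventuallyLE, ae_restrict_iff' measurableSet_Icc]
  have ha : ∀ᵐ x : ℝ, x ≠ a := by simp [ae_iff, measure_singleton]
  have hb : ∀ᵐ x : ℝ, x ≠ b := by simp [ae_iff, measure_singleton]
  filter_upwards [hvg, hv.boundedVariationOn.ae_differentiableAt_of_mem_uIcc, ha, hb]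
    with x h1 h2 h3 h4 hx
  have hd : HasDerivAt f (c * deriv v x).re x := by
    have h := ((h2 (by rwa [uIcc_of_le hab])).hasDerivAt.const_mul c)
    exact Complex.reCLM.hasFDerivAt.comp_hasDerivAt x h
  rw [hd.deriv]
  calc (c * deriv v x).re ≤ ‖c * deriv v x‖ := Complex.re_le_norm _
    _ = ‖deriv v x‖ := by rw [norm_mul, hc, one_mul]
    _ ≤ g x := h1 ⟨lt_of_le_of_ne hx.1 h3.symm, lt_of_le_of_ne hx.2 h4⟩

theorem integrable_exp_abs_mul {μ : Measure ℝ} {g : ℝ → ℝ} (hg : Integrable g μ)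
    {τ : ℝ} (hτ : 0 ≤ τ) (x : ℝ) : Integrable (fun t => Real.exp (-(τ * |x - t|)) * g t) μ := by
  refine hg.bdd_mul (c := 1) (by fun_prop) (ae_of_all _ fun t => ?_)
  rw [Real.norm_eq_abs, Real.abs_exp, Real.exp_le_one_iff]
  have : 0 ≤ τ * |x - t| := by positivity
  linarith

/-- For `g ∈ L₁(0, π)` the integrals `∫ exp (-τ |x - t|) g t dt` tend to `0` as `τ → ∞`, uniformly
in `x`: on a short interval around `x` the integral of `g` is small by absolute continuity of the
integral, and off that interval the kernel is small. -/
theorem eventually_integral_exp_abs_mul_le {g : ℝ → ℝ} (hg : Integrable g intervalMeasure)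
    (hg0 : ∀ t, 0 ≤ g t) {ε : ℝ} (hε : 0 < ε) :
    ∀ᶠ τ : ℝ in atTop, ∀ x, ∫ t, Real.exp (-(τ * |x - t|)) * g t ∂intervalMeasure ≤ ε := by
  have h1 : ∃ δ > 0, ∀ x, ∫ t in Metric.ball x δ, g t ∂intervalMeasure ≤ ε / 2 := by
    -- Otherwise there are balls with radii tending to `0` on which the integral of `g` is large.
    by_contra! hcon
    choose x hx using fun n : ℕ => hcon (1 / ((n : ℝ) + 1)) (by positivity)
    have ht : Tendsto (intervalMeasure ∘ fun n : ℕ => Metric.ball (x n) (1 / ((n : ℝ) + 1))) atTop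
        (nhds 0) := by
      have hlim : Tendsto (fun n : ℕ => ENNReal.ofReal (2 * (1 / ((n : ℝ) + 1)))) atTop
          (nhds 0) := by
        have := (tendsto_one_div_add_atTop_nhds_zero_nat (𝕜 := ℝ)).const_mul 2
        simpa using ENNReal.tendsto_ofReal this
      refine tendsto_of_tendsto_of_tendsto_of_le_of_le tendsto_const_nhds hlim
        (fun _ => zero_le) fun n => ?_
      calc intervalMeasure (Metric.ball (x n) (1 / ((n : ℝ) + 1)))
          ≤ volume (Metric.ball (x n) (1 / ((n : ℝ) + 1))) := Measure.restrict_apply_le _ _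
        _ = _ := Real.volume_ball _ _
    have h0 := hg.tendsto_setIntegral_nhds_zero ht
    obtain ⟨n, hn⟩ := (h0.eventually (gt_mem_nhds (half_pos hε))).exists
    exact absurd hn (not_lt.mpr (hx n).le)
  obtain ⟨δ, hδ, hball⟩ := h1
  set G := ∫ t, g t ∂intervalMeasure with hG
  have hG0 : 0 ≤ G := integral_nonneg hg0
  have h2 : Tendsto (fun τ : ℝ => Real.exp (-(τ * δ)) * G) atTop (nhds 0) := by
    have : Tendsto (fun τ : ℝ => Real.exp (-(τ * δ))) atTop (nhds 0) :=
      Real.tendsto_exp_neg_atTop_nhds_zero.comp (tendsto_id.atTop_mul_const hδ)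
    simpa using this.mul_const G
  filter_upwards [h2.eventually (gt_mem_nhds (half_pos hε)), eventually_ge_atTop 0]
    with τ hτ hτ0 x
  have hi2 : Integrable (fun t => Real.exp (-(τ * δ)) * g t) intervalMeasure := hg.const_mul _
  have hi1 : Integrable (fun t => (Metric.ball x δ).indicator g t) intervalMeasure :=
    hg.indicator measurableSet_ball
  calc ∫ t, Real.exp (-(τ * |x - t|)) * g t ∂intervalMeasure
      ≤ ∫ t, ((Metric.ball x δ).indicator g t + Real.exp (-(τ * δ)) * g t) ∂intervalMeasure := by
        refine integral_mono (integrable_exp_abs_mul hg hτ0 x) (hi1.add hi2) fun t => ?_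
        have hgt := hg0 t
        by_cases ht : t ∈ Metric.ball x δ
        · simp only [indicator_of_mem ht]
          have : Real.exp (-(τ * |x - t|)) ≤ 1 := by
            rw [Real.exp_le_one_iff]
            have : 0 ≤ τ * |x - t| := by positivity
            linarith
          have h3 : 0 ≤ Real.exp (-(τ * δ)) * g t := by positivity
          nlinarith
        · simp only [indicator_of_notMem ht, zero_add]
          rw [Metric.mem_ball, Real.dist_eq, abs_sub_comm, not_lt] at ht
          gcongr
    _ = ∫ t in Metric.ball x δ, g t ∂intervalMeasure + Real.exp (-(τ * δ)) * G := by
        rw [integral_add hi1 hi2, integral_indicator measurableSet_ball, integral_const_mul]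
    _ ≤ ε := by linarith [hball x]

/-- Variation of constants, as an inequality: a solution of `u' = ν u + O(h)` is compared at `a` and
`b`. The base point `x` only normalizes the integrating factor to be `1` at `x`; below it is one of
the two ends. -/
theorem norm_exp_mul_sub_le_integral {u : ℝ → ℂ} {ν : ℂ} {a b : ℝ} (hab : a ≤ b)
    (hu : AbsolutelyContinuousOnInterval u a b) {h : ℝ → ℝ} (x : ℝ)
    (hh : IntervalIntegrable (fun t => Real.exp (-(ν.re * (t - x))) * h t) volume a b)
    (huh : ∀ᵐ t, t ∈ Ioo a b → ‖deriv u t - ν * u t‖ ≤ h t) :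
    ‖Complex.exp (-(ν * (b - x))) * u b - Complex.exp (-(ν * (a - x))) * u a‖ ≤
      ∫ t in a..b, Real.exp (-(ν.re * (t - x))) * h t := by
  have he : ∀ t : ℝ, HasDerivAt (fun t : ℝ => Complex.exp (-(ν * (t - x))))
      (Complex.exp (-(ν * (t - x))) * (-ν)) t := fun t => by
    have h1 : HasDerivAt (fun t : ℝ => ((t : ℂ) - x)) 1 t :=
      (Complex.ofRealCLM.hasDerivAt (x := t)).sub_const (x : ℂ)
    simpa using ((h1.const_mul ν).neg).cexp
  have hcd : ContDiff ℝ 1 (fun t : ℝ => Complex.exp (-(ν * (t - x)))) := by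
    have : ContDiff ℝ 1 (fun t : ℝ => (t : ℂ)) := Complex.ofRealCLM.contDiff
    fun_prop
  have hac : AbsolutelyContinuousOnInterval
      (fun t : ℝ => Complex.exp (-(ν * (t - x))) * u t) a b :=
    hcd.contDiffOn.absolutelyContinuousOnInterval.smul hu
  refine norm_sub_le_integral_of_norm_deriv_le hab hac hh ?_
  filter_upwards [huh, hu.boundedVariationOn.ae_differentiableAt_of_mem_uIcc] with t h1 h2 ht
  have hd := (he t).mul (h2 (by rw [uIcc_of_le hab]; exact Ioo_subset_Icc_self ht)).hasDerivAt
  have hd' : deriv (fun t : ℝ => Complex.exp (-(ν * (t - x))) * u t) t =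
      Complex.exp (-(ν * (t - x))) * (deriv u t - ν * u t) := by
    refine hd.deriv.trans ?_
    ring
  rw [hd', norm_mul, Complex.norm_exp]
  have hre : (-(ν * ((t : ℂ) - x))).re = -(ν.re * (t - x)) := by simp
  rw [hre]
  gcongr
  exact h1 ht

/-! ### Solutions of the first order system concentrate at the ends of the interval -/

/-- The weight `exp (-τ x / 2) + exp (-τ (π - x) / 2)`, which decays away from both ends of
`(0, π)` at half of the rate `τ` of the free solutions. The other half of the rate is left to make
the perturbation integrals small. -/
noncomputable def edgeWeight (τ x : ℝ) : ℝ :=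
  Real.exp (-(τ / 2 * x)) + Real.exp (-(τ / 2 * (Real.pi - x)))

theorem edgeWeight_pos (τ x : ℝ) : 0 < edgeWeight τ x := by unfold edgeWeight; positivity

@[fun_prop]
theorem continuous_edgeWeight (τ : ℝ) : Continuous (edgeWeight τ) := by
  unfold edgeWeight; fun_prop

theorem exp_abs_mul_edgeWeight_le {τ : ℝ} (hτ : 0 ≤ τ) (x t : ℝ) :
    Real.exp (-(τ / 2 * |x - t|)) * edgeWeight τ t ≤ edgeWeight τ x := by
  unfold edgeWeight
  rw [mul_add, ← Real.exp_add, ← Real.exp_add]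
  have h1 := neg_abs_le (x - t)
  have h2 := le_abs_self (x - t)
  gcongr <;> nlinarith

theorem exp_pair_le_edgeWeight {τ x : ℝ} (hτ : 0 ≤ τ) (hx : x ∈ Icc 0 Real.pi) :
    Real.exp (-(τ * x)) + Real.exp (-(τ * (Real.pi - x))) ≤ edgeWeight τ x := by
  unfold edgeWeight
  have h1 : 0 ≤ τ * x := mul_nonneg hτ hx.1
  have h2 : 0 ≤ τ * (Real.pi - x) := mul_nonneg hτ (sub_nonneg.2 hx.2)
  exact add_le_add (Real.exp_le_exp.2 (by linarith)) (Real.exp_le_exp.2 (by linarith))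

/-- `(u₁, u₂)` solves on `[0, π]` a system `u₁' = ν u₁ + p u₂`, `u₂' = -ν u₂ + q u₁` whose
off-diagonal coefficients satisfy `|p|, |q| ≤ g`. Only these bounds on the coefficients matter, so
the equations are recorded as inequalities. -/
structure IsNearlyDiagonal (g : ℝ → ℝ) (ν : ℂ) (u₁ u₂ : ℝ → ℂ) : Prop where
  ac₁ : AbsolutelyContinuousOnInterval u₁ 0 Real.pi
  ac₂ : AbsolutelyContinuousOnInterval u₂ 0 Real.pi
  ode₁ : ∀ᵐ x ∂intervalMeasure, ‖deriv u₁ x - ν * u₁ x‖ ≤ g x * ‖u₂ x‖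
  ode₂ : ∀ᵐ x ∂intervalMeasure, ‖deriv u₂ x - -ν * u₂ x‖ ≤ g x * ‖u₁ x‖

theorem IsNearlyDiagonal.swap {g : ℝ → ℝ} {ν : ℂ} {u₁ u₂ : ℝ → ℂ}
    (h : IsNearlyDiagonal g ν u₁ u₂) : IsNearlyDiagonal g (-ν) u₂ u₁ :=
  ⟨h.ac₂, h.ac₁, h.ode₂, by simpa using h.ode₁⟩

theorem intervalIntegral_le_integral {f : ℝ → ℝ} (hf : Integrable f intervalMeasure)
    (hf0 : ∀ t, 0 ≤ f t) {a b : ℝ} (ha : 0 ≤ a) (hab : a ≤ b) (hb : b ≤ Real.pi) :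
    ∫ t in a..b, f t ≤ ∫ t, f t ∂intervalMeasure := by
  rw [intervalIntegral.integral_of_le hab, integral_Ioc_eq_integral_Ioo]
  exact setIntegral_mono_set hf (ae_of_all _ hf0)
    (LE.le.eventuallyLE (Ioo_subset_Ioo ha hb))

theorem intervalIntegrable_of_integrable {f : ℝ → ℝ} (hf : Integrable f intervalMeasure)
    {a b : ℝ} (ha : 0 ≤ a) (hab : a ≤ b) (hb : b ≤ Real.pi) :
    IntervalIntegrable f volume a b := by
  rw [intervalIntegrable_iff_integrableOn_Ioo_of_le hab]
  exact IntegrableOn.mono_set hf (Ioo_subset_Ioo ha hb)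

theorem integrable_of_continuousOn {f : ℝ → ℝ} (hf : ContinuousOn f (Icc 0 Real.pi)) :
    Integrable f intervalMeasure :=
  (hf.integrableOn_Icc (μ := volume)).mono_set Ioo_subset_Icc_self

theorem ae_restrict_imp {p : ℝ → Prop} (hp : ∀ᵐ x ∂intervalMeasure, p x) {a b : ℝ}
    (ha : 0 ≤ a) (hb : b ≤ Real.pi) : ∀ᵐ x, x ∈ Ioo a b → p x := by
  rw [ae_restrict_iff' measurableSet_Ioo] at hp
  filter_upwards [hp] with x hx hxa using hx (Ioo_subset_Ioo ha hb hxa)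

/-- The perturbation term in the variation of constants formula, for a source of size
`g * S * edgeWeight`, is again of size `edgeWeight`, with the small factor `ε`. -/
theorem intervalIntegral_kernel_le {g : ℝ → ℝ} (hg : Integrable g intervalMeasure)
    (hg0 : ∀ t, 0 ≤ g t) {τ ε S : ℝ} (hτ : 0 ≤ τ) (hS : 0 ≤ S) {x : ℝ}
    (hker : ∫ t, Real.exp (-(τ / 2 * |x - t|)) * g t ∂intervalMeasure ≤ ε)
    {a b : ℝ} (ha : 0 ≤ a) (hab : a ≤ b) (hb : b ≤ Real.pi) :
    IntervalIntegrable (fun t => Real.exp (-(τ * |x - t|)) * (g t * (S * edgeWeight τ t)))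
      volume a b ∧
    ∫ t in a..b, Real.exp (-(τ * |x - t|)) * (g t * (S * edgeWeight τ t)) ≤
      ε * S * edgeWeight τ x := by
  have hk : Integrable (fun t => Real.exp (-(τ / 2 * |x - t|)) * g t) intervalMeasure :=
    integrable_exp_abs_mul hg (by positivity) x
  have hi : IntervalIntegrable
      (fun t => Real.exp (-(τ * |x - t|)) * (g t * (S * edgeWeight τ t))) volume a b := by
    have h := (intervalIntegrable_of_integrable hg ha hab hb).mul_continuousOn
      (g := fun t => Real.exp (-(τ * |x - t|)) * (S * edgeWeight τ t))
      (Continuous.continuousOn (by fun_prop))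
    convert h using 2
    ring
  refine ⟨hi, ?_⟩
  have hw := edgeWeight_pos τ x
  calc ∫ t in a..b, Real.exp (-(τ * |x - t|)) * (g t * (S * edgeWeight τ t))
      ≤ ∫ t in a..b, (Real.exp (-(τ / 2 * |x - t|)) * g t) * (S * edgeWeight τ x) := by
        refine intervalIntegral.integral_mono_on hab hi
          ((intervalIntegrable_of_integrable hk ha hab hb).mul_const _) fun t _ => ?_
        have h1 : Real.exp (-(τ * |x - t|)) =
            Real.exp (-(τ / 2 * |x - t|)) * Real.exp (-(τ / 2 * |x - t|)) := by
          rw [← Real.exp_add]; ring_nf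
        have h2 := exp_abs_mul_edgeWeight_le hτ x t
        have h3 : 0 ≤ Real.exp (-(τ / 2 * |x - t|)) * g t * S :=
          mul_nonneg (mul_nonneg (Real.exp_nonneg _) (hg0 t)) hS
        rw [h1]
        nlinarith [mul_le_mul_of_nonneg_left h2 h3]
    _ = (∫ t in a..b, Real.exp (-(τ / 2 * |x - t|)) * g t) * (S * edgeWeight τ x) :=
        intervalIntegral.integral_mul_const _ _
    _ ≤ ε * (S * edgeWeight τ x) := by
        gcongr
        exact (intervalIntegral_le_integral hk
          (fun t => mul_nonneg (Real.exp_nonneg _) (hg0 t)) ha hab hb).trans hker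
    _ = _ := by ring

namespace IsNearlyDiagonal

variable {g : ℝ → ℝ} {ν : ℂ} {u₁ u₂ : ℝ → ℂ} {τ ε S : ℝ}

theorem continuousOn_fst (h : IsNearlyDiagonal g ν u₁ u₂) : ContinuousOn u₁ (Icc 0 Real.pi) := by
  simpa [uIcc_of_le Real.pi_pos.le] using h.ac₁.continuousOn

theorem continuousOn_snd (h : IsNearlyDiagonal g ν u₁ u₂) : ContinuousOn u₂ (Icc 0 Real.pi) := by
  simpa [uIcc_of_le Real.pi_pos.le] using h.ac₂.continuousOn

/-- If `Re ν = -τ ≤ 0`, the first component is integrated from the left end. -/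
theorem norm_fst_sub_le (h : IsNearlyDiagonal g ν u₁ u₂) (hg : Integrable g intervalMeasure)
    (hg0 : ∀ t, 0 ≤ g t) (hν : ν.re = -τ) (hτ : 0 ≤ τ) (hS : 0 ≤ S)
    (hker : ∀ x, ∫ t, Real.exp (-(τ / 2 * |x - t|)) * g t ∂intervalMeasure ≤ ε)
    (hu₂ : ∀ x ∈ Icc 0 Real.pi, ‖u₂ x‖ ≤ S * edgeWeight τ x) {x : ℝ} (hx : x ∈ Icc 0 Real.pi) :
    ‖u₁ x - Complex.exp (ν * x) * u₁ 0‖ ≤ ε * S * edgeWeight τ x := by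
  obtain ⟨hi, hle⟩ := intervalIntegral_kernel_le hg hg0 hτ hS (hker x) le_rfl hx.1 hx.2
  have hkey : ∀ t ∈ uIcc 0 x, Real.exp (-(τ * |x - t|)) * (g t * (S * edgeWeight τ t)) =
      Real.exp (-(ν.re * (t - x))) * (g t * (S * edgeWeight τ t)) := fun t ht => by
    rw [uIcc_of_le hx.1] at ht
    rw [abs_of_nonneg (sub_nonneg.2 ht.2), hν]
    ring_nf
  have hd := norm_exp_mul_sub_le_integral (ν := ν) hx.1
    (h.ac₁.mono (uIcc_subset_uIcc left_mem_uIcc (by rwa [uIcc_of_le Real.pi_pos.le])))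
    (h := fun t => g t * (S * edgeWeight τ t)) x
    (hi.congr fun t ht => hkey t (uIoc_subset_uIcc ht)) (by
      filter_upwards [ae_restrict_imp h.ode₁ le_rfl hx.2] with t ht htm
      exact (ht htm).trans (mul_le_mul_of_nonneg_left
        (hu₂ t ⟨htm.1.le, htm.2.le.trans hx.2⟩) (hg0 t)))
  rw [← intervalIntegral.integral_congr hkey] at hd
  refine le_trans (le_of_eq ?_) (hd.trans hle)
  simp

/-- If `Re ν = -τ ≤ 0`, the second component is integrated from the right end. -/
theorem norm_snd_sub_le (h : IsNearlyDiagonal g ν u₁ u₂) (hg : Integrable g intervalMeasure)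
    (hg0 : ∀ t, 0 ≤ g t) (hν : ν.re = -τ) (hτ : 0 ≤ τ) (hS : 0 ≤ S)
    (hker : ∀ x, ∫ t, Real.exp (-(τ / 2 * |x - t|)) * g t ∂intervalMeasure ≤ ε)
    (hu₁ : ∀ x ∈ Icc 0 Real.pi, ‖u₁ x‖ ≤ S * edgeWeight τ x) {x : ℝ} (hx : x ∈ Icc 0 Real.pi) :
    ‖u₂ x - Complex.exp (ν * (Real.pi - x)) * u₂ Real.pi‖ ≤ ε * S * edgeWeight τ x := by
  obtain ⟨hi, hle⟩ := intervalIntegral_kernel_le hg hg0 hτ hS (hker x) hx.1 hx.2 le_rfl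
  have hkey : ∀ t ∈ uIcc x Real.pi, Real.exp (-(τ * |x - t|)) * (g t * (S * edgeWeight τ t)) =
      Real.exp (-((-ν).re * (t - x))) * (g t * (S * edgeWeight τ t)) := fun t ht => by
    rw [uIcc_of_le hx.2] at ht
    rw [abs_of_nonpos (sub_nonpos.2 ht.1), Complex.neg_re, hν]
    ring_nf
  have hd := norm_exp_mul_sub_le_integral (ν := -ν) hx.2
    (h.ac₂.mono (uIcc_subset_uIcc (by rwa [uIcc_of_le Real.pi_pos.le]) right_mem_uIcc))
    (h := fun t => g t * (S * edgeWeight τ t)) x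
    (hi.congr fun t ht => hkey t (uIoc_subset_uIcc ht)) (by
      filter_upwards [ae_restrict_imp h.ode₂ hx.1 le_rfl] with t ht htm
      exact (ht htm).trans (mul_le_mul_of_nonneg_left
        (hu₁ t ⟨hx.1.trans htm.1.le, htm.2.le⟩) (hg0 t)))
  rw [← intervalIntegral.integral_congr hkey] at hd
  refine le_trans (le_of_eq ?_) (hd.trans hle)
  rw [norm_sub_rev]
  simp

/-- Each component is close, relative to the weight, to the free solution with the same value at
the end where that component is free to be large: `0` for `u₁` and `π` for `u₂`. -/
theorem norm_sub_edge_exp_le (h : IsNearlyDiagonal g ν u₁ u₂) (hg : Integrable g intervalMeasure)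
    (hg0 : ∀ t, 0 ≤ g t) (hν : ν.re = -τ) (hτ : 0 ≤ τ) (hε : ε ≤ 1 / 2)
    (hker : ∀ x, ∫ t, Real.exp (-(τ / 2 * |x - t|)) * g t ∂intervalMeasure ≤ ε) :
    ∀ x ∈ Icc 0 Real.pi,
      ‖u₁ x - Complex.exp (ν * x) * u₁ 0‖ ≤
        max ‖u₁ 0‖ ‖u₂ Real.pi‖ * (2 * ε * edgeWeight τ x) ∧
      ‖u₂ x - Complex.exp (ν * (Real.pi - x)) * u₂ Real.pi‖ ≤
        max ‖u₁ 0‖ ‖u₂ Real.pi‖ * (2 * ε * edgeWeight τ x) := by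
  set m := max ‖u₁ 0‖ ‖u₂ Real.pi‖ with hm
  have hε0 : 0 ≤ ε := (integral_nonneg fun t => mul_nonneg (Real.exp_nonneg _) (hg0 t)).trans
    (hker 0)
  -- `S` is the best constant in `max ‖u₁‖ ‖u₂‖ ≤ S * edgeWeight`; at a point where it is attained
  -- the estimates give `S ≤ m + ε * S`.
  obtain ⟨x₀, hx₀, hmax⟩ := isCompact_Icc.exists_isMaxOn
    (nonempty_Icc.2 Real.pi_pos.le)
    (f := fun x => max ‖u₁ x‖ ‖u₂ x‖ / edgeWeight τ x)
    ((h.continuousOn_fst.norm.sup h.continuousOn_snd.norm).div (continuous_edgeWeight τ).continuousOn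
      fun x _ => (edgeWeight_pos τ x).ne')
  set S := max ‖u₁ x₀‖ ‖u₂ x₀‖ / edgeWeight τ x₀ with hS
  have hw₀ := edgeWeight_pos τ x₀
  have hS0 : 0 ≤ S := by positivity
  have hle : ∀ x ∈ Icc 0 Real.pi, max ‖u₁ x‖ ‖u₂ x‖ ≤ S * edgeWeight τ x := fun x hx =>
    (div_le_iff₀ (edgeWeight_pos τ x)).1 (hmax hx)
  have hle₁ := fun x hx => (le_max_left _ _).trans (hle x hx)
  have hle₂ := fun x hx => (le_max_right _ _).trans (hle x hx)
  have e₁ := fun x (hx : x ∈ Icc 0 Real.pi) =>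
    h.norm_fst_sub_le hg hg0 hν hτ hS0 hker hle₂ hx
  have e₂ := fun x (hx : x ∈ Icc 0 Real.pi) =>
    h.norm_snd_sub_le hg hg0 hν hτ hS0 hker hle₁ hx
  have hSm : S ≤ 2 * m := by
    have hexp := exp_pair_le_edgeWeight hτ hx₀
    have n₁ : ‖Complex.exp (ν * x₀) * u₁ 0‖ ≤ edgeWeight τ x₀ * m := by
      rw [norm_mul, Complex.norm_exp]
      have : (ν * x₀).re = -(τ * x₀) := by simp [hν]
      rw [this]
      gcongr
      · linarith [Real.exp_pos (-(τ * (Real.pi - x₀)))]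
      · exact le_max_left _ _
    have n₂ : ‖Complex.exp (ν * (Real.pi - x₀)) * u₂ Real.pi‖ ≤ edgeWeight τ x₀ * m := by
      rw [norm_mul, Complex.norm_exp]
      have : (ν * (Real.pi - x₀)).re = -(τ * (Real.pi - x₀)) := by simp [hν]
      rw [this]
      gcongr
      · linarith [Real.exp_pos (-(τ * x₀))]
      · exact le_max_right _ _
    have hb : max ‖u₁ x₀‖ ‖u₂ x₀‖ ≤ edgeWeight τ x₀ * m + ε * S * edgeWeight τ x₀ := by
      refine max_le ?_ ?_
      · linarith [norm_le_norm_add_norm_sub' (u₁ x₀) (Complex.exp (ν * x₀) * u₁ 0), e₁ x₀ hx₀]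
      · linarith [norm_le_norm_add_norm_sub' (u₂ x₀)
          (Complex.exp (ν * (Real.pi - x₀)) * u₂ Real.pi), e₂ x₀ hx₀]
    have hSe : S * edgeWeight τ x₀ = max ‖u₁ x₀‖ ‖u₂ x₀‖ := div_mul_cancel₀ _ hw₀.ne'
    have : S ≤ m + ε * S := by
      refine le_of_mul_le_mul_right ?_ hw₀
      linarith
    nlinarith
  have hfin : ∀ x, ε * S * edgeWeight τ x ≤ m * (2 * ε * edgeWeight τ x) := fun x => by
    have := mul_le_mul_of_nonneg_left hSm (mul_nonneg hε0 (edgeWeight_pos τ x).le)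
    linarith
  exact fun x hx => ⟨(e₁ x hx).trans (hfin x), (e₂ x hx).trans (hfin x)⟩

end IsNearlyDiagonal

/-! ### Integrals of the exponential weights -/

theorem integral_pi_sub (f : ℝ → ℝ) :
    ∫ x, f (Real.pi - x) ∂intervalMeasure = ∫ x, f x ∂intervalMeasure := by
  have h (f : ℝ → ℝ) : ∫ x, f x ∂intervalMeasure = ∫ x in (0 : ℝ)..Real.pi, f x := by
    rw [intervalIntegral.integral_of_le Real.pi_pos.le, integral_Ioc_eq_integral_Ioo]
  rw [h, h]
  simp [intervalIntegral.integral_comp_sub_left]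

theorem integral_exp_neg_mul {c : ℝ} (hc : c ≠ 0) :
    ∫ x, Real.exp (-(c * x)) ∂intervalMeasure = (1 - Real.exp (-(c * Real.pi))) / c := by
  rw [← integral_Ioc_eq_integral_Ioo, ← intervalIntegral.integral_of_le Real.pi_pos.le,
    intervalIntegral.integral_eq_sub_of_hasDerivAt (f := fun x => -Real.exp (-(c * x)) / c)]
  · simp; ring
  · intro x _
    have h := ((((hasDerivAt_id x).const_mul c).neg).exp.neg).div_const c
    exact h.congr_deriv (by simp only [id]; field_simp; rfl)
  · exact Continuous.intervalIntegrable (by fun_prop) _ _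

theorem integral_exp_neg_mul_le {τ : ℝ} (hτ : 0 < τ) :
    ∫ x, Real.exp (-(τ * x)) ∂intervalMeasure ≤ 1 / τ := by
  rw [integral_exp_neg_mul hτ.ne']
  gcongr
  linarith [Real.exp_pos (-(τ * Real.pi))]

theorem le_integral_exp_neg_mul_sq {τ : ℝ} (hτ : 1 ≤ τ) :
    1 / (4 * τ) ≤ ∫ x, Real.exp (-(τ * x)) ^ 2 ∂intervalMeasure := by
  have h (x : ℝ) : Real.exp (-(τ * x)) ^ 2 = Real.exp (-((2 * τ) * x)) := by
    rw [← Real.exp_nat_mul]; push_cast; ring_nf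
  simp_rw [h]
  rw [integral_exp_neg_mul (by positivity)]
  have hπ := Real.pi_gt_three
  have h1 : 1 + 2 * τ * Real.pi ≤ Real.exp (2 * τ * Real.pi) := by
    linarith [Real.add_one_le_exp (2 * τ * Real.pi)]
  have h2 : Real.exp (-(2 * τ * Real.pi)) ≤ 1 / 2 := by
    rw [Real.exp_neg, ← one_div]
    exact one_div_le_one_div_of_le two_pos (by nlinarith)
  rw [div_le_div_iff₀ (by positivity) (by positivity)]
  nlinarith

theorem integral_edgeWeight_sq_le {τ : ℝ} (hτ : 0 < τ) :
    ∫ x, edgeWeight τ x ^ 2 ∂intervalMeasure ≤ 4 / τ := by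
  have hi₁ : Integrable (fun x => 2 * Real.exp (-(τ * x))) intervalMeasure :=
    integrable_of_continuousOn (Continuous.continuousOn (by fun_prop))
  have hi₂ : Integrable (fun x => 2 * Real.exp (-(τ * (Real.pi - x)))) intervalMeasure :=
    integrable_of_continuousOn (Continuous.continuousOn (by fun_prop))
  calc ∫ x, edgeWeight τ x ^ 2 ∂intervalMeasure
      ≤ ∫ x, (2 * Real.exp (-(τ * x)) + 2 * Real.exp (-(τ * (Real.pi - x))))
          ∂intervalMeasure := by
        refine integral_mono (integrable_of_continuousOn
          (Continuous.continuousOn (by fun_prop))) (hi₁.add hi₂) fun x => ?_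
        have h (s : ℝ) : Real.exp (-(τ * s)) = Real.exp (-(τ / 2 * s)) ^ 2 := by
          rw [← Real.exp_nat_mul]; push_cast; ring_nf
        simp only [edgeWeight, h]
        nlinarith [sq_nonneg (Real.exp (-(τ / 2 * x)) - Real.exp (-(τ / 2 * (Real.pi - x))))]
    _ = 4 * ∫ x, Real.exp (-(τ * x)) ∂intervalMeasure := by
        rw [integral_add hi₁ hi₂, integral_const_mul, integral_const_mul,
          integral_pi_sub (fun x => Real.exp (-(τ * x)))]
        ring
    _ ≤ 4 * (1 / τ) := by gcongr; exact integral_exp_neg_mul_le hτ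
    _ = 4 / τ := by ring

/-! ### Lower bound for the norm and upper bound for the pairing -/

/-- Lower bound for the `L₂` norm of a perturbation `u` of a free solution `e` with amplitude `m`:
both `∫ ‖e‖²` and the square of the error are of order `m² / τ`, and the error carries the small
factor `ε²`. -/
theorem sq_le_integral_norm_sq {u e : ℝ → ℂ} {p : ℝ → ℝ} {m τ ε : ℝ} (hτ : 1 ≤ τ)
    (hε0 : 0 ≤ ε) (hε : ε ≤ 1 / 32) (hu : ContinuousOn u (Icc 0 Real.pi)) (hp : Continuous p)
    (hpτ : 1 / (4 * τ) ≤ ∫ x, p x ^ 2 ∂intervalMeasure)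
    (he : ∀ x, ‖e x‖ = m * p x)
    (h : ∀ x ∈ Icc 0 Real.pi, ‖u x - e x‖ ≤ m * (2 * ε * edgeWeight τ x)) :
    m ^ 2 ≤ 16 * τ * ∫ x, ‖u x‖ ^ 2 ∂intervalMeasure := by
  have hτ0 : 0 < τ := by linarith
  have hi₁ : Integrable (fun x => 2 * ‖u x‖ ^ 2) intervalMeasure :=
    integrable_of_continuousOn ((hu.norm.pow 2).const_smul (2 : ℝ))
  have hi₂ : Integrable (fun x => 8 * ε ^ 2 * m ^ 2 * edgeWeight τ x ^ 2) intervalMeasure :=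
    integrable_of_continuousOn (Continuous.continuousOn (by fun_prop))
  have hint : m ^ 2 * ∫ x, p x ^ 2 ∂intervalMeasure ≤
      2 * ∫ x, ‖u x‖ ^ 2 ∂intervalMeasure +
        8 * ε ^ 2 * m ^ 2 * ∫ x, edgeWeight τ x ^ 2 ∂intervalMeasure := by
    rw [← integral_const_mul, ← integral_const_mul, ← integral_const_mul, ← integral_add hi₁ hi₂]
    refine setIntegral_mono_on (integrable_of_continuousOn
      (Continuous.continuousOn (by fun_prop))) (hi₁.add hi₂) measurableSet_Ioo fun x hx => ?_
    have h1 := h x (Ioo_subset_Icc_self hx)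
    have h2 : m * p x ≤ ‖u x‖ + m * (2 * ε * edgeWeight τ x) := by
      rw [← he x]
      linarith [norm_le_norm_add_norm_sub (u x) (e x)]
    have h3 : 0 ≤ m * p x := he x ▸ norm_nonneg _
    have h4 := pow_le_pow_left₀ h3 h2 2
    nlinarith [sq_nonneg (‖u x‖ - m * (2 * ε * edgeWeight τ x))]
  have hw := integral_edgeWeight_sq_le hτ0
  have hε2 : ε ^ 2 ≤ 1 / 1024 := by nlinarith
  have h5 : m ^ 2 * (1 / (4 * τ)) ≤ m ^ 2 * ∫ x, p x ^ 2 ∂intervalMeasure := by gcongr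
  have h6 : 8 * ε ^ 2 * m ^ 2 * ∫ x, edgeWeight τ x ^ 2 ∂intervalMeasure ≤
      8 * (1 / 1024) * m ^ 2 * (4 / τ) := by gcongr
  have h7 : m ^ 2 * (1 / (4 * τ)) * τ ≤
      (2 * ∫ x, ‖u x‖ ^ 2 ∂intervalMeasure + 8 * (1 / 1024) * m ^ 2 * (4 / τ)) * τ := by
    gcongr; linarith
  have h8 : m ^ 2 * (1 / (4 * τ)) * τ = m ^ 2 / 4 := by field_simp
  have h9 : (2 * ∫ x, ‖u x‖ ^ 2 ∂intervalMeasure + 8 * (1 / 1024) * m ^ 2 * (4 / τ)) * τ =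
      2 * τ * ∫ x, ‖u x‖ ^ 2 ∂intervalMeasure + m ^ 2 / 32 := by field_simp; ring
  rw [h8, h9] at h7
  -- `h7` is now `m² / 4 ≤ 2 τ ∫ ‖u‖² + m² / 32`, slightly more than what is claimed.
  nlinarith [sq_nonneg m]

namespace IsNearlyDiagonal

variable {g : ℝ → ℝ} {ν : ℂ} {u₁ u₂ : ℝ → ℂ} {τ ε : ℝ}

/-- Pointwise upper bounds for both components and a lower bound for the `L₂` norm, in terms of the
same amplitude `m = max ‖u₁ 0‖ ‖u₂ π‖`. -/
theorem exists_edge_bounds (h : IsNearlyDiagonal g ν u₁ u₂) (hg : Integrable g intervalMeasure)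
    (hg0 : ∀ t, 0 ≤ g t) (hν : ν.re = -τ) (hτ : 1 ≤ τ) (hε : ε ≤ 1 / 32)
    (hker : ∀ x, ∫ t, Real.exp (-(τ / 2 * |x - t|)) * g t ∂intervalMeasure ≤ ε) :
    ∃ m : ℝ, 0 ≤ m ∧
      (∀ x ∈ Icc 0 Real.pi,
        ‖u₁ x‖ ≤ m * (Real.exp (-(τ * x)) + 2 * ε * edgeWeight τ x) ∧
        ‖u₂ x‖ ≤ m * (Real.exp (-(τ * (Real.pi - x))) + 2 * ε * edgeWeight τ x)) ∧
      m ^ 2 ≤ 16 * τ * ∫ x, (‖u₁ x‖ ^ 2 + ‖u₂ x‖ ^ 2) ∂intervalMeasure := by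
  have hε0 : 0 ≤ ε := (integral_nonneg fun t => mul_nonneg (Real.exp_nonneg _) (hg0 t)).trans
    (hker 0)
  have hτ0 : 0 ≤ τ := by linarith
  have hprof := h.norm_sub_edge_exp_le hg hg0 hν hτ0 (hε.trans (by norm_num)) hker
  have he₁ : ∀ x : ℝ, ‖Complex.exp (ν * x) * u₁ 0‖ = ‖u₁ 0‖ * Real.exp (-(τ * x)) := fun x => by
    rw [norm_mul, Complex.norm_exp, mul_comm]
    simp [hν]
  have he₂ : ∀ x : ℝ, ‖Complex.exp (ν * (Real.pi - x)) * u₂ Real.pi‖ =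
      ‖u₂ Real.pi‖ * Real.exp (-(τ * (Real.pi - x))) := fun x => by
    rw [norm_mul, Complex.norm_exp, mul_comm]
    simp [hν]
  set m := max ‖u₁ 0‖ ‖u₂ Real.pi‖ with hm
  have hm0 : 0 ≤ m := (norm_nonneg _).trans (le_max_left _ _)
  refine ⟨m, hm0, fun x hx => ⟨?_, ?_⟩, ?_⟩
  · have h1 := norm_le_norm_add_norm_sub' (u₁ x) (Complex.exp (ν * x) * u₁ 0)
    have h2 : ‖u₁ 0‖ * Real.exp (-(τ * x)) ≤ m * Real.exp (-(τ * x)) := by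
      gcongr; exact le_max_left _ _
    rw [he₁] at h1
    linarith [(hprof x hx).1]
  · have h1 := norm_le_norm_add_norm_sub' (u₂ x)
      (Complex.exp (ν * (Real.pi - x)) * u₂ Real.pi)
    have h2 : ‖u₂ Real.pi‖ * Real.exp (-(τ * (Real.pi - x))) ≤
        m * Real.exp (-(τ * (Real.pi - x))) := by
      gcongr; exact le_max_right _ _
    rw [he₂] at h1
    linarith [(hprof x hx).2]
  · have hi₁ : Integrable (fun x => ‖u₁ x‖ ^ 2) intervalMeasure :=
      integrable_of_continuousOn (h.continuousOn_fst.norm.pow 2)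
    have hi₂ : Integrable (fun x => ‖u₂ x‖ ^ 2) intervalMeasure :=
      integrable_of_continuousOn (h.continuousOn_snd.norm.pow 2)
    have n₁ : 0 ≤ ∫ x, ‖u₁ x‖ ^ 2 ∂intervalMeasure := integral_nonneg fun x => by positivity
    have n₂ : 0 ≤ ∫ x, ‖u₂ x‖ ^ 2 ∂intervalMeasure := integral_nonneg fun x => by positivity
    rw [integral_add hi₁ hi₂]
    rcases max_choice ‖u₁ 0‖ ‖u₂ Real.pi‖ with hc | hc
    · have := sq_le_integral_norm_sq hτ hε0 hε h.continuousOn_fst (by fun_prop)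
        (le_integral_exp_neg_mul_sq hτ) (fun x => by rw [he₁ x, hm, hc])
        (fun x hx => (hprof x hx).1)
      nlinarith
    · have := sq_le_integral_norm_sq hτ hε0 hε h.continuousOn_snd (by fun_prop)
        ((le_integral_exp_neg_mul_sq hτ).trans_eq
          (integral_pi_sub fun x => Real.exp (-(τ * x)) ^ 2).symm)
        (fun x => by rw [he₂ x, hm, hc]) (fun x hx => (hprof x hx).2)
      nlinarith

/-- The components of `v` are paired in the opposite order in `hv`: where `u₁` decays from the left
end, `v₁` decays from the right end, and conversely for `u₂` and `v₂`. Hence the pairing of `u` and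
`v` is much smaller than the product of the norms. -/
theorem integral_pairing_le {μ : ℂ} {v₁ v₂ : ℝ → ℂ} {a b : ℝ}
    (hu : IsNearlyDiagonal g ν u₁ u₂) (hv : IsNearlyDiagonal g μ v₂ v₁)
    (hg : Integrable g intervalMeasure) (hg0 : ∀ t, 0 ≤ g t)
    (hν : ν.re = -τ) (hμ : μ.re = -τ) (hτ : 1 ≤ τ) (hε : ε ≤ 1 / 32)
    (hker : ∀ x, ∫ t, Real.exp (-(τ / 2 * |x - t|)) * g t ∂intervalMeasure ≤ ε)
    (ha0 : 0 ≤ a) (hb0 : 0 ≤ b)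
    (ha : ∫ x, (‖u₁ x‖ ^ 2 + ‖u₂ x‖ ^ 2) ∂intervalMeasure = a ^ 2)
    (hb : ∫ x, (‖v₁ x‖ ^ 2 + ‖v₂ x‖ ^ 2) ∂intervalMeasure = b ^ 2) :
    ∫ x, (‖u₁ x‖ * ‖v₁ x‖ + ‖u₂ x‖ * ‖v₂ x‖) ∂intervalMeasure ≤
      32 * (Real.pi * τ * Real.exp (-(τ * Real.pi)) + 12 * ε) * (a * b) := by
  have hε0 : 0 ≤ ε := (integral_nonneg fun t => mul_nonneg (Real.exp_nonneg _) (hg0 t)).trans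
    (hker 0)
  have hτ0 : 0 < τ := by linarith
  obtain ⟨m, hm0, hum, hma⟩ := hu.exists_edge_bounds hg hg0 hν hτ hε hker
  obtain ⟨n, hn0, hvn, hnb⟩ := hv.exists_edge_bounds hg hg0 hμ hτ hε hker
  rw [ha] at hma
  simp_rw [add_comm (‖v₂ _‖ ^ 2), hb] at hnb
  have hmn : m * n ≤ 16 * τ * (a * b) := by
    refine abs_le_of_sq_le_sq' ?_ (by positivity) |>.2
    calc (m * n) ^ 2 = m ^ 2 * n ^ 2 := by ring
      _ ≤ (16 * τ * a ^ 2) * (16 * τ * b ^ 2) := by gcongr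
      _ = _ := by ring
  have hpt : ∀ x ∈ Ioo 0 Real.pi, ‖u₁ x‖ * ‖v₁ x‖ + ‖u₂ x‖ * ‖v₂ x‖ ≤
      2 * (m * n) * (Real.exp (-(τ * Real.pi)) + 3 * ε * edgeWeight τ x ^ 2) := fun x hx => by
    have hx' := Ioo_subset_Icc_self hx
    obtain ⟨hu₁, hu₂⟩ := hum x hx'
    obtain ⟨hv₂, hv₁⟩ := hvn x hx'
    have hpq := exp_pair_le_edgeWeight hτ0.le hx'
    have hprod : Real.exp (-(τ * x)) * Real.exp (-(τ * (Real.pi - x))) =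
        Real.exp (-(τ * Real.pi)) := by rw [← Real.exp_add]; ring_nf
    have hw := edgeWeight_pos τ x
    set w := edgeWeight τ x
    set p := Real.exp (-(τ * x)) with hp
    set q := Real.exp (-(τ * (Real.pi - x))) with hq
    have hp0 : 0 < p := Real.exp_pos _
    have hq0 : 0 < q := Real.exp_pos _
    have hcore : (p + 2 * ε * w) * (q + 2 * ε * w) ≤
        Real.exp (-(τ * Real.pi)) + 3 * ε * w ^ 2 := by
      rw [← hprod]
      have h1 : 2 * ε * w * (p + q) ≤ 2 * ε * w * w := by gcongr
      have h2 : ε * (ε * w ^ 2) ≤ 1 / 32 * (ε * w ^ 2) := by gcongr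
      nlinarith [mul_nonneg hε0 (sq_nonneg w)]
    calc ‖u₁ x‖ * ‖v₁ x‖ + ‖u₂ x‖ * ‖v₂ x‖
        ≤ m * (p + 2 * ε * w) * (n * (q + 2 * ε * w)) +
          m * (q + 2 * ε * w) * (n * (p + 2 * ε * w)) := by gcongr
      _ = 2 * (m * n) * ((p + 2 * ε * w) * (q + 2 * ε * w)) := by ring
      _ ≤ _ := by gcongr
  have hi₁ : Integrable (fun _ : ℝ => Real.exp (-(τ * Real.pi))) intervalMeasure :=
    integrable_of_continuousOn continuousOn_const
  have hi₂ : Integrable (fun x => 3 * ε * edgeWeight τ x ^ 2) intervalMeasure :=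
    integrable_of_continuousOn (Continuous.continuousOn (by fun_prop))
  calc ∫ x, (‖u₁ x‖ * ‖v₁ x‖ + ‖u₂ x‖ * ‖v₂ x‖) ∂intervalMeasure
      ≤ ∫ x, 2 * (m * n) * (Real.exp (-(τ * Real.pi)) + 3 * ε * edgeWeight τ x ^ 2)
          ∂intervalMeasure :=
        setIntegral_mono_on (integrable_of_continuousOn
          ((hu.continuousOn_fst.norm.mul hv.continuousOn_snd.norm).add
            (hu.continuousOn_snd.norm.mul hv.continuousOn_fst.norm)))
          (integrable_of_continuousOn (Continuous.continuousOn (by fun_prop)))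
          measurableSet_Ioo hpt
    _ = 2 * (m * n) * (Real.pi * Real.exp (-(τ * Real.pi)) +
          3 * ε * ∫ x, edgeWeight τ x ^ 2 ∂intervalMeasure) := by
        rw [integral_const_mul, integral_add hi₁ hi₂, integral_const_mul, integral_const]
        simp [Measure.real, Real.pi_pos.le]
    _ ≤ 2 * (16 * τ * (a * b)) * (Real.pi * Real.exp (-(τ * Real.pi)) + 3 * ε * (4 / τ)) := by
        gcongr
        exact integral_edgeWeight_sq_le hτ0
    _ = _ := by field_simp; ring

end IsNearlyDiagonal

/-! ### Schauder bases and the operators in the Hilbert space -/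

/-- Uniform minimality of a Schauder basis: the rank one operators `x ↦ ⟪z n, x⟫ • b n` are
differences of consecutive partial sum projections, which are uniformly bounded. -/
theorem exists_norm_mul_norm_le_of_schauderBasis {E : Type*} [NormedAddCommGroup E]
    [InnerProductSpace ℂ E] [CompleteSpace E] (b : SchauderBasis ℂ E) {z : ℕ → E}
    (hz : ∀ n k, ⟪z k, b.basis n⟫_ℂ = if n = k then 1 else 0) :
    ∃ C, 0 ≤ C ∧ ∀ n, ‖b.basis n‖ * ‖z n‖ ≤ C := by
  obtain ⟨C, hC⟩ := b.exists_norm_proj_le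
  have hC0 : 0 ≤ C := (norm_nonneg _).trans (hC 0)
  have hcoord : ∀ n x, b.coord n x = ⟪z n, x⟫_ℂ := fun n x => by
    have h1 : Tendsto (fun N => ⟪z n, b.proj N x⟫_ℂ) atTop (nhds ⟪z n, x⟫_ℂ) :=
      tendsto_const_nhds.inner (b.tendsto_proj x)
    refine tendsto_nhds_unique (tendsto_const_nhds.congr' ?_) h1
    filter_upwards [eventually_gt_atTop n] with N hN
    simp [hz, hN]
  refine ⟨2 * C, by positivity, fun n => ?_⟩
  have hdiff : b.coord n (z n) • b.basis n = b.proj (n + 1) (z n) - b.proj n (z n) := by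
    simp [Finset.sum_range_succ]
  have hn : ‖z n‖ ^ 2 * ‖b.basis n‖ ≤ 2 * C * ‖z n‖ := by
    calc ‖z n‖ ^ 2 * ‖b.basis n‖ = ‖b.coord n (z n) • b.basis n‖ := by
          rw [norm_smul, hcoord, inner_self_eq_norm_sq_to_K]; simp
      _ ≤ ‖b.proj (n + 1) (z n)‖ + ‖b.proj n (z n)‖ := hdiff ▸ norm_sub_le _ _
      _ ≤ C * ‖z n‖ + C * ‖z n‖ :=
          add_le_add (ContinuousLinearMap.le_of_opNorm_le _ (hC _) _)
            (ContinuousLinearMap.le_of_opNorm_le _ (hC _) _)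
      _ = _ := by ring
  rcases (norm_nonneg (z n)).eq_or_lt with h0 | h0
  · rw [← h0, mul_zero]; positivity
  · refine le_of_mul_le_mul_right ?_ h0
    linarith

theorem norm_sq_eq_integral (f : H) {u₁ u₂ : ℝ → ℂ}
    (hu : ∀ᵐ x ∂intervalMeasure, f.fst x = u₁ x ∧ f.snd x = u₂ x) :
    ∫ x, (‖u₁ x‖ ^ 2 + ‖u₂ x‖ ^ 2) ∂intervalMeasure = ‖f‖ ^ 2 := by
  have h (k : Lp ℂ 2 intervalMeasure) : ‖k‖ ^ 2 = ∫ x, ‖k x‖ ^ 2 ∂intervalMeasure := by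
    have h1 : ((‖k‖ ^ 2 : ℝ) : ℂ) = ((∫ x, ‖k x‖ ^ 2 ∂intervalMeasure : ℝ) : ℂ) := by
      rw [← integral_complex_ofReal]
      push_cast
      refine (inner_self_eq_norm_sq_to_K (𝕜 := ℂ) k).symm.trans ?_
      rw [L2.inner_def]
      simp_rw [inner_self_eq_norm_sq_to_K]
      rfl
    exact_mod_cast h1
  rw [WithLp.prod_norm_sq_eq_of_L2, h, h, ← integral_add]
  · refine integral_congr_ae ?_
    filter_upwards [hu] with x hx
    rw [hx.1, hx.2]
  · exact (memLp_two_iff_integrable_sq_norm (Lp.aestronglyMeasurable _)).1 (Lp.memLp _)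
  · exact (memLp_two_iff_integrable_sq_norm (Lp.aestronglyMeasurable _)).1 (Lp.memLp _)

theorem norm_inner_le_integral (f k : H) {u₁ u₂ v₁ v₂ : ℝ → ℂ}
    (hu : ∀ᵐ x ∂intervalMeasure, f.fst x = u₁ x ∧ f.snd x = u₂ x)
    (hv : ∀ᵐ x ∂intervalMeasure, k.fst x = v₁ x ∧ k.snd x = v₂ x) :
    ‖⟪k, f⟫_ℂ‖ ≤ ∫ x, (‖u₁ x‖ * ‖v₁ x‖ + ‖u₂ x‖ * ‖v₂ x‖) ∂intervalMeasure := by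
  have h : ⟪k, f⟫_ℂ = ∫ x, (⟪k.fst x, f.fst x⟫_ℂ + ⟪k.snd x, f.snd x⟫_ℂ) ∂intervalMeasure := by
    rw [integral_add (L2.integrable_inner _ _) (L2.integrable_inner _ _), ← L2.inner_def,
      ← L2.inner_def]
    rfl
  rw [h]
  have hi := ((L2.integrable_inner (𝕜 := ℂ) k.fst f.fst).norm.add
    (L2.integrable_inner (𝕜 := ℂ) k.snd f.snd).norm)
  have hpt (a b : ℂ) : ‖⟪a, b⟫_ℂ‖ = ‖b‖ * ‖a‖ := by simp
  refine norm_integral_le_of_norm_le (hi.congr ?_) ?_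
  · filter_upwards [hu, hv] with x hux hvx
    simp only [Pi.add_apply, hpt, hux.1, hux.2, hvx.1, hvx.2]
  · filter_upwards [hu, hv] with x hux hvx
    refine (norm_add_le _ _).trans_eq ?_
    rw [hpt, hpt, hux.1, hux.2, hvx.1, hvx.2]

/-- The equation `L y = λ y` reads `u₁' = iλ u₁ - i P u₂`, `u₂' = -iλ u₂ + i Q u₁`. -/
theorem MaximalGraph.exists_nearlyDiagonal {P Q : ℝ → ℂ} {y : H} {lam : ℂ}
    (h : MaximalGraph P Q y (lam • y)) :
    ∃ u₁ u₂ : ℝ → ℂ, (∀ᵐ x ∂intervalMeasure, y.fst x = u₁ x ∧ y.snd x = u₂ x) ∧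
      IsNearlyDiagonal (fun x => ‖P x‖ + ‖Q x‖) (Complex.I * lam) u₁ u₂ := by
  obtain ⟨u₁, u₂, h₁, h₂, hu, hw⟩ := h
  have hs₁ : ∀ᵐ x ∂intervalMeasure, (lam • y).fst x = lam * y.fst x := Lp.coeFn_smul lam y.fst
  have hs₂ : ∀ᵐ x ∂intervalMeasure, (lam • y).snd x = lam * y.snd x := Lp.coeFn_smul lam y.snd
  refine ⟨u₁, u₂, hu, h₁, h₂, ?_, ?_⟩
  · filter_upwards [hu, hw, hs₁] with x hux hwx hsx
    have h3 : lam * u₁ x = -Complex.I * deriv u₁ x + P x * u₂ x := by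
      rw [← hwx.1, hsx, hux.1]
    have h4 : deriv u₁ x - Complex.I * lam * u₁ x = -Complex.I * (P x * u₂ x) := by
      linear_combination -Complex.I * h3 + deriv u₁ x * Complex.I_sq
    rw [h4, norm_mul, norm_mul, norm_neg, Complex.norm_I, one_mul]
    gcongr
    linarith [norm_nonneg (Q x)]
  · filter_upwards [hu, hw, hs₂] with x hux hwx hsx
    have h3 : lam * u₂ x = Complex.I * deriv u₂ x + Q x * u₁ x := by
      rw [← hwx.2, hsx, hux.2]
    have h4 : deriv u₂ x - -(Complex.I * lam) * u₂ x = Complex.I * (Q x * u₁ x) := by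
      linear_combination Complex.I * h3 + deriv u₂ x * Complex.I_sq
    rw [h4, norm_mul, norm_mul, Complex.norm_I, one_mul]
    gcongr
    linarith [norm_nonneg (P x)]

/-- Eigenfunctions of `L` and `L*` for conjugate eigenvalues far from the real axis are nearly
orthogonal. The sign of `Im λ` decides which component of `y` decays from the left end. -/
theorem norm_inner_le_of_eigenfunctions {P Q : ℝ → ℂ} {y z : H} {lam : ℂ} {τ ε : ℝ}
    (hP : Integrable P intervalMeasure) (hQ : Integrable Q intervalMeasure)
    (hy : MaximalGraph P Q y (lam • y)) (hz : AdjointGraph P Q z (conj lam • z))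
    (hlam : |lam.im| = τ) (hτ : 1 ≤ τ) (hε : ε ≤ 1 / 32)
    (hker : ∀ x, ∫ t, Real.exp (-(τ / 2 * |x - t|)) * (‖P t‖ + ‖Q t‖) ∂intervalMeasure ≤ ε) :
    ‖⟪z, y⟫_ℂ‖ ≤
      32 * (Real.pi * τ * Real.exp (-(τ * Real.pi)) + 12 * ε) * (‖y‖ * ‖z‖) := by
  have hg : Integrable (fun x => ‖P x‖ + ‖Q x‖) intervalMeasure := hP.norm.add hQ.norm
  have hg0 : ∀ x, 0 ≤ ‖P x‖ + ‖Q x‖ := fun x => by positivity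
  obtain ⟨u₁, u₂, hu, hud⟩ := hy.exists_nearlyDiagonal
  obtain ⟨v₁, v₂, hv, hvd⟩ := MaximalGraph.exists_nearlyDiagonal hz
  have hgz : (fun x => ‖conj (Q x)‖ + ‖conj (P x)‖) = fun x => ‖P x‖ + ‖Q x‖ := by
    ext x; simp [add_comm]
  rw [hgz] at hvd
  refine (norm_inner_le_integral y z hu hv).trans ?_
  have hu' := norm_sq_eq_integral y hu
  have hv' := norm_sq_eq_integral z hv
  -- If `Im λ ≥ 0` then `Re (i λ) = -τ`, while `Re (i conj λ) = τ`, so the components of `z` are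
  -- interchanged; if `Im λ ≤ 0` those of `y` are.
  rcases le_total 0 lam.im with h0 | h0
  · rw [abs_of_nonneg h0] at hlam
    exact hud.integral_pairing_le hvd.swap hg hg0 (by simp [hlam]) (by simp [hlam]) hτ hε hker
      (norm_nonneg _) (norm_nonneg _) hu' hv'
  · rw [abs_of_nonpos h0] at hlam
    simp_rw [add_comm (‖u₁ _‖ ^ 2)] at hu'
    simp_rw [add_comm (‖v₁ _‖ ^ 2)] at hv'
    simp_rw [add_comm (‖u₁ _‖ * _)]
    exact hud.swap.integral_pairing_le hvd hg hg0 (by simp [← hlam]) (by simp [← hlam]) hτ hε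
      hker (norm_nonneg _) (norm_nonneg _) hu' hv'

end Dirac

theorem theorem1 (P Q : ℝ → ℂ)
    (hP : Integrable P Dirac.intervalMeasure) (hQ : Integrable Q Dirac.intervalMeasure)
    (y z : ℕ → Dirac.H) (lam : ℕ → ℂ) (ordy ordz : ℕ → ℕ)
    (hcomplete : Dirac.IsCompleteSystem y) (hminimal : Dirac.IsMinimalSystem y)
    (hy : ∀ n, Dirac.IsRootFunction (Dirac.MaximalGraph P Q) (lam n) (ordy n) (y n))
    (hbiorth : ∀ n k, ⟪z k, y n⟫_ℂ = if n = k then 1 else 0)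
    (hz : ∀ n, Dirac.IsRootFunction (Dirac.AdjointGraph P Q) (conj (lam n)) (ordz n) (z n))
    (hy_fin : {n | ordy n ≠ 0}.Finite) (hz_fin : {n | ordz n ≠ 0}.Finite)
    (hlim : limsup (fun n => ((|(lam n).im| : ℝ) : EReal)) atTop = ⊤) :
    ¬ Dirac.IsBasis y := by
  rintro ⟨b, rfl⟩
  obtain ⟨C, hC0, hC⟩ := Dirac.exists_norm_mul_norm_le_of_schauderBasis b hbiorth
  -- `500` exceeds `416 = 32 * (1 + 12)`, so that the final estimate `1 ≤ 416 * ε * C` fails.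
  set ε : ℝ := min (1 / 32) (1 / (500 * (C + 1))) with hεdef
  have hε0 : 0 < ε := by positivity
  have hε : ε ≤ 1 / 32 := min_le_left _ _
  have hεC : ε * (500 * (C + 1)) ≤ 1 :=
    (le_div_iff₀ (by positivity)).1 (min_le_right _ _)
  have hg : Integrable (fun x => ‖P x‖ + ‖Q x‖) Dirac.intervalMeasure := hP.norm.add hQ.norm
  have hker := (tendsto_id.atTop_div_const (two_pos : (0 : ℝ) < 2)).eventually
    (Dirac.eventually_integral_exp_abs_mul_le hg (fun x => by positivity) hε0)
  have hexp : Tendsto (fun τ : ℝ => Real.pi * τ * Real.exp (-(τ * Real.pi))) atTop (nhds 0) := by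
    have h := (Real.tendsto_pow_mul_exp_neg_atTop_nhds_zero 1).comp
      (tendsto_id.atTop_mul_const Real.pi_pos)
    refine h.congr fun τ => ?_
    simp [mul_comm]
  obtain ⟨T, hT⟩ := eventually_atTop.1
    (hker.and ((hexp.eventually (gt_mem_nhds hε0)).and (eventually_ge_atTop 1)))
  have hfreq : ∃ᶠ n in atTop, T ≤ |(lam n).im| := by
    have h : ((T : ℝ) : EReal) < limsup (fun n => ((|(lam n).im| : ℝ) : EReal)) atTop := by
      rw [hlim]; exact EReal.coe_lt_top T
    exact (frequently_lt_of_lt_limsup (by isBoundedDefault) h).mono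
      fun n hn => (EReal.coe_lt_coe_iff.1 hn).le
  have hcof : ∀ᶠ n in atTop, ordy n = 0 ∧ ordz n = 0 := by
    rw [← Nat.cofinite_eq_atTop]
    filter_upwards [hy_fin.compl_mem_cofinite, hz_fin.compl_mem_cofinite] with n h1 h2
    exact ⟨by simpa using h1, by simpa using h2⟩
  obtain ⟨n, hnT, hny, hnz⟩ := (hfreq.and_eventually hcof).exists
  have hyn := hy n
  have hzn := hz n
  rw [hny] at hyn
  rw [hnz] at hzn
  obtain ⟨hk, he, h1⟩ := hT _ hnT
  have hle := Dirac.norm_inner_le_of_eigenfunctions hP hQ hyn.2 hzn.2 rfl h1 hε hk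
  rw [hbiorth n n, if_pos rfl, norm_one] at hle
  have hfin : 32 * (Real.pi * |(lam n).im| * Real.exp (-(|(lam n).im| * Real.pi)) + 12 * ε) *
      (‖b.basis n‖ * ‖z n‖) ≤ 32 * (ε + 12 * ε) * C := by
    gcongr
    exact hC n
  nlinarith
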